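/- Notation. Let $[n]=\{1,\dots,n\}$. The $n$-cube $Q_n$ is the graph whose vertices are the subsets of $[n]$, two being adjacent iff they differ in exactly one element $i$; this $i$ is the direction of the edge. For $i\in[n]$ let $\sigma_i$ be the automorphism $X\mapsto X\oplus\{i\}$ of $Q_n$, where $\oplus$ is symmetric difference. The signature of a spanning tree $T$ of $Q_n$ is $(a_1,\dots,a_n)$, where $a_i$ is the number of edges of $T$ in direction $i$. An edge slide replaces an edge $e$ of a spanning tree $T$, in a direction $j\neq i$ and with $\sigma_i(e)\notin T$, by $\sigma_i(e)$, provided that the result is again a spanning tree. For a signature $\mathcal S$ of $Q_n$, $\mathcal E(\mathcal S)$ is the graph whose vertices are the spanning trees of $Q_n$ with signature $\mathcal S$, two being adjacent iff they are related by an edge slide. For $R\subseteq[n]$ with complement $\bar R$, let $Q_n/\bar R$ be the multigraph obtained from $Q_n$ by contracting every edge in a direction belonging to $\bar R$. Its vertices are labelled by the subsets $X\subseteq R$ (the vertex $X$ arising from all $W\subseteq [n]$ with $W\cap R=X$), and its edges are the edges of $Q_n$ in directions belonging to $R$. Directions, the maps $\sigma_i$ on edges $(i\in[n])$, spanning trees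 and edge slides are defined for $Q_n/\bar R$ in the same way. For a tuple $\mathcal S'$ indexed by $R$, $\mathcal E_{Q_n/\bar R}(\mathcal S')$ is the graph of the spanning trees of $Q_n/\bar R$ that have $\mathcal S'_i$ edges in direction $i$ for each $i\in R$, with adjacency given by edge slides. A signature $\mathcal S=(a_1,\dots,a_n)$ of $Q_n$ is ordered if $a_1\le\dots\le a_n$. Its excess at $k$ is $\varepsilon_k(\mathcal S)=\min_{K\subseteq[n],\,|K|=k}\sum_{i\in K}a_i-(2^k-1)$. An ordered signature is saturated above direction $r$ if $\varepsilon_k(\mathcal S)=0$ for all $r\le k\le n$. Write $\square$ for the Cartesian product of graphs and $G^{\square m}$ for the product of $m$ copies of $G$. Corollary 6.10. Let $1\le r\le n$, and suppose that the ordered signature $\mathcal S=(a_1,\dots,a_n)$ of $Q_n$ is saturated above direction $r$. Let $R=[r]$ and $\mathcal S'=(a_1,\dots,a_r)$. Then $$\mathcal E(\mathcal S)\;\cong\;\mathcal E_{Q_n/\bar R}(\mathcal S')\;\square\;\bigl(Q_{2^{n-r}-(n-r)-1}\bigr)^{\square 2^r}\;\cong\;\mathcal E_{Q_n/\bar R}(\mathcal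 S')\;\square\;Q_N,$$ where $N=2^r\bigl(2^{n-r}-(n-r)-1\bigr)$. -/

import Mathlib

namespace EdgeSlide

/-- The `n`-cube `Q_n`: its vertices are the subsets of `Fin n` (which plays the role of
`{1, …, n}`), and two subsets are adjacent iff they differ in exactly one element. -/
def cube (n : ℕ) : SimpleGraph (Finset (Fin n)) where
  Adj X Y := (symmDiff X Y).card = 1
  symm := ⟨fun X Y h => by rwa [symmDiff_comm]⟩
  loopless := ⟨fun X h => by simp at h⟩

/-- An edge, regarded as an unordered pair of vertices of `Q_n`. The graphs below (the cube and
its contractions) all have edges of this type. -/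
abbrev Edge (n : ℕ) : Type := Sym2 (Finset (Fin n))

/-- The automorphism `σ_i` of `Q_n`, `X ↦ X ⊕ {i}`. -/
def shift {n : ℕ} (i : Fin n) (X : Finset (Fin n)) : Finset (Fin n) := symmDiff X {i}

/-- The action of `σ_i` on edges. -/
def shiftEdge {n : ℕ} (i : Fin n) (e : Edge n) : Edge n := e.map (shift i)

/-- The edge `e` has direction `i`, i.e. `e = {X, X ⊕ {i}}` for some `X`. -/
def HasDir {n : ℕ} (e : Edge n) (i : Fin n) : Prop := ∃ X : Finset (Fin n), e = s(X, shift i X)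

theorem shift_shift {n : ℕ} (i : Fin n) (X : Finset (Fin n)) : shift i (shift i X) = X := by
  simp [shift]

theorem shift_comm {n : ℕ} (i j : Fin n) (X : Finset (Fin n)) :
    shift i (shift j X) = shift j (shift i X) := by
  simp only [shift, symmDiff_assoc, symmDiff_comm {i} {j}]

theorem shiftEdge_shiftEdge {n : ℕ} (i : Fin n) (e : Edge n) : shiftEdge i (shiftEdge i e) = e := by
  induction e using Sym2.ind with
  | h X Y => simp [shiftEdge, shift_shift]

theorem HasDir.shiftEdge {n : ℕ} {e : Edge n} {j : Fin n} (h : HasDir e j) (i : Fin n) :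
    HasDir (shiftEdge i e) j := by
  obtain ⟨X, rfl⟩ := h
  exact ⟨shift i X, by simp [EdgeSlide.shiftEdge, shift_comm i j]⟩

/-- A multigraph is a tree if it is connected and has no cycles. Cycles of length one and two are
loops and pairs of parallel edges, so this says that the multigraph is simple and that, as a
simple graph, it is a tree. -/
def IsTree {α β : Type*} (G : Graph α β) : Prop := G.Simple ∧ G.toSimpleGraph.IsTree

/-- The cube `Q_n` with each edge named by the pair of its endpoints. -/
def cubeGraph (n : ℕ) : Graph (Finset (Fin n)) (Edge n) := Graph.ofSimpleGraph (cube n)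

/-- The contraction `Q_n / S`: every edge of `Q_n` in a direction belonging to `S` is contracted.
Each class of vertices of `Q_n` that are thereby identified is labelled by the set `X` disjoint
from `S` such that the class consists of all `W` with `W \ S = X`. The edges are the edges of
`Q_n` in the directions outside `S` (none of which are identified with each other): the edge
`{W, W ⊕ {i}}` of `Q_n` becomes an edge joining `W \ S` to `(W ⊕ {i}) \ S`. So the parallel edges
joining `X` to `X ⊕ {i}` are the edges `{X ∪ Y, (X ⊕ {i}) ∪ Y}`, one for each `Y ⊆ S`. -/
def contraction {n : ℕ} (S : Finset (Fin n)) : Graph (Finset (Fin n)) (Edge n) where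
  vertexSet := {X | Disjoint X S}
  edgeSet := {e | ∃ i, i ∉ S ∧ HasDir e i}
  IsLink e X Y := ∃ W : Finset (Fin n), ∃ i : Fin n,
    i ∉ S ∧ e = s(W, shift i W) ∧ X = W \ S ∧ Y = shift i W \ S
  isLink_symm := by
    refine fun e _ => ⟨?_⟩
    rintro X Y ⟨W, i, hi, he, hX, hY⟩
    exact ⟨shift i W, i, hi, by rw [he, shift_shift, Sym2.eq_swap], hY, by rw [shift_shift, hX]⟩
  eq_or_eq_of_isLink_of_isLink := by
    rintro e X Y V Z ⟨W, i, _, he, hX, hY⟩ ⟨W', i', _, he', hV, hZ⟩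
    rw [he, Sym2.eq_iff] at he'
    rcases he' with ⟨h, _⟩ | ⟨h, _⟩
    · left; rw [hX, hV, h]
    · right; rw [hX, hZ, h]
  edge_mem_iff_exists_isLink := by
    refine fun e => ⟨?_, ?_⟩
    · rintro ⟨i, hi, W, he⟩
      exact ⟨_, _, W, i, hi, he, rfl, rfl⟩
    · rintro ⟨_, _, W, i, hi, he, _, _⟩
      exact ⟨i, hi, W, he⟩
  left_mem_of_isLink := by
    rintro e X Y ⟨W, i, _, _, rfl, _⟩
    exact Finset.sdiff_disjoint

/-- The spanning trees of `G`, given by their edge sets. -/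
def SpanningTree {n : ℕ} (G : Graph (Finset (Fin n)) (Edge n)) : Type :=
  {F : Set (Edge n) // F ⊆ G.edgeSet ∧ IsTree (G.restrict F)}

/-- The number of edges of the spanning tree `T` in direction `i`. -/
noncomputable def dirCount {n : ℕ} {G : Graph (Finset (Fin n)) (Edge n)} (T : SpanningTree G)
    (i : Fin n) : ℕ :=
  Set.ncard {e : Edge n | e ∈ T.1 ∧ HasDir e i}

/-- The spanning tree `T₂` is obtained from the spanning tree `T₁` by an edge slide: an edge `e` of
`T₁` in a direction `j ≠ i` such that `σ_i(e)` is not in `T₁` is replaced by `σ_i(e)`. -/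
def IsSlide {n : ℕ} {G : Graph (Finset (Fin n)) (Edge n)} (T₁ T₂ : SpanningTree G) : Prop :=
  ∃ e ∈ T₁.1, ∃ i j : Fin n, HasDir e j ∧ j ≠ i ∧ shiftEdge i e ∉ T₁.1 ∧
    T₂.1 = insert (shiftEdge i e) (T₁.1 \ {e})

/-- The edge slide graph of `G`. -/
def slideGraph {n : ℕ} (G : Graph (Finset (Fin n)) (Edge n)) : SimpleGraph (SpanningTree G) where
  Adj := IsSlide
  symm := by
    refine ⟨?_⟩
    rintro T₁ T₂ ⟨e, he, i, j, hj, hji, hn, hT⟩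
    have hne : e ≠ shiftEdge i e := fun h => hn (h ▸ he)
    refine ⟨shiftEdge i e, ?_, i, j, hj.shiftEdge i, hji, ?_, ?_⟩
    · rw [hT]; exact Set.mem_insert _ _
    · rw [shiftEdge_shiftEdge, hT]
      simp [hne]
    · rw [shiftEdge_shiftEdge, hT]
      ext f
      by_cases h1 : f = e
      · subst h1; simp [he]
      · by_cases h2 : f = shiftEdge i e
        · subst h2; simp [hn, h1]
        · simp [h1, h2]
  loopless := by
    refine ⟨?_⟩
    rintro T ⟨e, _, i, _, _, _, hn, hT⟩
    exact hn (hT ▸ Set.mem_insert _ _)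

/-- The tuple `a` is a signature of `Q_n`: it is the signature of a spanning tree of `Q_n`. -/
def IsSignature {n : ℕ} (a : Fin n → ℕ) : Prop := ∃ T : SpanningTree (cubeGraph n), dirCount T = a

/-- The spanning trees of `Q_n` with signature `a`. -/
def sigTrees {n : ℕ} (a : Fin n → ℕ) : Set (SpanningTree (cubeGraph n)) := {T | dirCount T = a}

/-- The edge slide graph of `a`, the subgraph of the edge slide graph of `Q_n` induced by the
spanning trees with signature `a`. -/
def sigSlideGraph {n : ℕ} (a : Fin n → ℕ) : SimpleGraph (sigTrees a) :=
  (slideGraph (cubeGraph n)).induce (sigTrees a)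

/-- The spanning trees of `Q_n / ([n] - R)` with signature `b`, a tuple indexed by the elements
of `R`. -/
def contractionTrees {n : ℕ} (R : Finset (Fin n)) (b : {i : Fin n // i ∈ R} → ℕ) :
    Set (SpanningTree (contraction Rᶜ)) :=
  {T | ∀ i : {i : Fin n // i ∈ R}, dirCount T i.1 = b i}

/-- The subgraph of the edge slide graph of `Q_n / ([n] - R)` induced by the spanning trees with
signature `b`. -/
def contractionSlideGraph {n : ℕ} (R : Finset (Fin n)) (b : {i : Fin n // i ∈ R} → ℕ) :
    SimpleGraph (contractionTrees R b) :=
  (slideGraph (contraction Rᶜ)).induce (contractionTrees R b)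

/-- The excess of `a` at `k`: the minimum of `∑ i ∈ K, a i` over the `k`-element sets `K` of
directions, minus `2 ^ k - 1`. -/
noncomputable def excess {n : ℕ} (a : Fin n → ℕ) (k : ℕ) : ℤ :=
  ((sInf {s : ℕ | ∃ K : Finset (Fin n), K.card = k ∧ s = ∑ i ∈ K, a i} : ℕ) : ℤ) - (2 ^ k - 1)

/-- The condition on an ordered signature `a` of `Q_n` to be saturated above direction `r`. -/
def SaturatedAbove {n : ℕ} (a : Fin n → ℕ) (r : ℕ) : Prop :=
  ∀ k : ℕ, r ≤ k → k ≤ n → excess a k = 0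

/-- The set `[r]` of the first `r` directions. -/
def firstDirs (n r : ℕ) : Finset (Fin n) := Finset.univ.filter (fun i => (i : ℕ) < r)

/-- The Cartesian power `G □ ⋯ □ G` with `m` factors: two tuples are adjacent iff they are adjacent
in one coordinate and agree in all others. -/
def boxPow {V : Type*} (G : SimpleGraph V) (m : ℕ) : SimpleGraph (Fin m → V) where
  Adj f g := ∃ i, G.Adj (f i) (g i) ∧ ∀ j, j ≠ i → f j = g j
  symm := by
    refine ⟨?_⟩
    rintro f g ⟨i, hi, h⟩
    exact ⟨i, hi.symm, fun j hj => (h j hj).symm⟩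
  loopless := by
    refine ⟨?_⟩
    rintro f ⟨i, hi, _⟩
    exact G.loopless.irrefl _ hi

end EdgeSlide

namespace EdgeSlide

/-! Number the directions from `0`. Saturation says that the first `k` entries of the signature sum
to `2 ^ k - 1` for every `k ≥ r`, so `a k = 2 ^ k` for each direction `k ≥ r`. If `T` is a spanning
tree with this signature, its edges in the first `k` directions connect the contraction of the cube
onto those directions, and they are just enough in number to form a spanning tree of it
(`Spans.dirPart`). For `k ≥ r` the tree on the first `k + 1` directions has no parallel edges, so
its `2 ^ k` edges in direction `k` lie over distinct subsets `X` of the directions below `k`. There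
are exactly `2 ^ k` such subsets, so each carries one edge (`Selective`, `selective_of_injOn`).

The edge over `X` is determined by one bit for each direction `l > k`. Thus `T` is encoded by a
spanning tree of the contraction onto the first `r` directions and a set of triples `(k, X, l)`.
Conversely every such pair comes from a spanning tree: connectivity climbs one direction at a time
(`Connects.firstDirs_succ`) and the edge count is right.

A slide of an edge in a direction below `r` is a slide in the contraction and keeps all bits. An
edge in a direction `j ≥ r` can slide only along some `i > j`, since otherwise it would leave its
subset `X` without an edge; such a slide flips one bit. Conversely each bit flip is a slide
(`SetSlide.dirPart_bits`, `setSlide_of_dirPart`, `setSlide_of_bits`). So the slide graph is a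
product with a cube whose dimension is the number of triples, computed in `card_bitIndex`. -/

theorem mem_shift {n : ℕ} {i l : Fin n} {X : Finset (Fin n)} :
    l ∈ shift i X ↔ (l ∈ X ↔ l ≠ i) := by
  simp only [shift, Finset.mem_symmDiff, Finset.mem_singleton]
  tauto

theorem mk_shift_eq_mk_shift_iff {n : ℕ} {i j : Fin n} {X Y : Finset (Fin n)} :
    (s(X, shift i X) : Edge n) = s(Y, shift j Y) ↔ i = j ∧ (X = Y ∨ X = shift j Y) := by
  have key : ∀ Z : Finset (Fin n), shift i Z = shift j Z → i = j := fun Z h => by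
    have h1 := mem_shift (i := i) (l := i) (X := Z)
    rw [h, mem_shift] at h1
    by_contra hne
    simp_all
  rw [Sym2.eq_iff]
  constructor
  · rintro (⟨rfl, h⟩ | ⟨rfl, h⟩)
    · exact ⟨key _ h, Or.inl rfl⟩
    · have : i = j := key (shift j Y) (by rw [h, shift_shift])
      exact ⟨this, Or.inr rfl⟩
  · rintro ⟨rfl, rfl | rfl⟩
    · exact Or.inl ⟨rfl, rfl⟩
    · exact Or.inr ⟨rfl, shift_shift _ _⟩

theorem HasDir.unique {n : ℕ} {e : Edge n} {i j : Fin n} (hi : HasDir e i) (hj : HasDir e j) :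
    i = j := by
  obtain ⟨X, rfl⟩ := hi
  obtain ⟨Y, h⟩ := hj
  exact (mk_shift_eq_mk_shift_iff.1 h).1

theorem shift_sdiff_compl_of_notMem {n : ℕ} {R : Finset (Fin n)} {i : Fin n} (hi : i ∉ R)
    (X : Finset (Fin n)) : shift i X \ Rᶜ = X \ Rᶜ := by
  ext l
  simp only [Finset.mem_sdiff, mem_shift, Finset.mem_compl, not_not]
  have : l ∈ R → l ≠ i := fun h h' => hi (h' ▸ h)
  tauto

theorem sdiff_compl_ne_shift_sdiff_compl {n : ℕ} {R : Finset (Fin n)} {i : Fin n} (hi : i ∈ R)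
    (X : Finset (Fin n)) : X \ Rᶜ ≠ shift i X \ Rᶜ := by
  intro h
  have := Finset.ext_iff.1 h i
  simp only [Finset.mem_sdiff, mem_shift, Finset.mem_compl, not_not] at this
  tauto

/-! ### Connectivity and a counting criterion for trees in a contraction -/

/-- The edges in `F`, together with the identification of vertices that agree on `R`, connect
all vertices: every class of vertices closed under both is empty or everything. -/
def Connects {n : ℕ} (F : Set (Edge n)) (R : Finset (Fin n)) : Prop :=
  ∀ P : Finset (Fin n) → Prop, (∀ X Y, X \ Rᶜ = Y \ Rᶜ → P X → P Y) →
    (∀ X Y, s(X, Y) ∈ F → P X → P Y) → ∀ X Y, P X → P Y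

theorem Connects.mono {n : ℕ} {F F' : Set (Edge n)} {R : Finset (Fin n)} (h : Connects F R)
    (hF : F ⊆ F') : Connects F' R :=
  fun P hP hP' => h P hP fun X Y hXY => hP' X Y (hF hXY)

/-- The pair of endpoints in `Q_n / Rᶜ` of an edge. -/
def ends {n : ℕ} (R : Finset (Fin n)) (e : Edge n) : Edge n := e.map (· \ Rᶜ)

section Criterion

variable {n : ℕ} {R : Finset (Fin n)} {F : Set (Edge n)}

theorem isLink_restrict_iff {e : Edge n} {X Y : Finset (Fin n)} :
    ((contraction Rᶜ).restrict F).IsLink e X Y ↔ e ∈ F ∧ ∃ W : Finset (Fin n), ∃ i : Fin n,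
      i ∈ R ∧ e = s(W, shift i W) ∧ X = W \ Rᶜ ∧ Y = shift i W \ Rᶜ := by
  simp [Graph.restrict, contraction, and_comm]

theorem ends_eq_of_isLink {e : Edge n} {X Y : Finset (Fin n)}
    (h : ((contraction Rᶜ).restrict F).IsLink e X Y) : ends R e = s(X, Y) := by
  obtain ⟨_, W, i, _, rfl, rfl, rfl⟩ := isLink_restrict_iff.1 h
  simp [ends]

theorem isLink_of_ends_eq (hF : F ⊆ (contraction Rᶜ).edgeSet) {e : Edge n}
    {X Y : Finset (Fin n)} (he : e ∈ F) (h : ends R e = s(X, Y)) :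
    ((contraction Rᶜ).restrict F).IsLink e X Y := by
  obtain ⟨i, hi, W, rfl⟩ := hF he
  have hi' : i ∈ R := by simpa using hi
  rw [isLink_restrict_iff]
  refine ⟨he, ?_⟩
  simp only [ends, Sym2.map_mk, Sym2.eq_iff] at h
  rcases h with ⟨h1, h2⟩ | ⟨h1, h2⟩
  · exact ⟨W, i, hi', rfl, h1.symm, h2.symm⟩
  · exact ⟨shift i W, i, hi', by rw [shift_shift, Sym2.eq_swap], h2.symm, by
      rw [shift_shift, h1]⟩

/-- A direction in `R` survives the contraction, so loops cannot occur and only parallel edges have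
to be excluded. -/
theorem simple_restrict_iff (hF : F ⊆ (contraction Rᶜ).edgeSet) :
    ((contraction Rᶜ).restrict F).Simple ↔ Set.InjOn (ends R) F := by
  constructor
  · intro hs e he f hf hef
    induction h : ends R e using Sym2.ind with
    | h X Y =>
      exact hs.eq_of_isLink (isLink_of_ends_eq hF he h) (isLink_of_ends_eq hF hf (hef ▸ h))
  · intro hinj
    refine { not_isLoopAt := ?_, eq_of_isLink := ?_ }
    · intro e x h
      obtain ⟨_, W, i, hi, _, h1, h2⟩ := isLink_restrict_iff.1 h
      exact sdiff_compl_ne_shift_sdiff_compl hi W (h1.symm.trans h2)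
    · intro e f x y he hf
      exact hinj (isLink_restrict_iff.1 he).1 (isLink_restrict_iff.1 hf).1
        ((ends_eq_of_isLink he).trans (ends_eq_of_isLink hf).symm)

theorem image_edgeSet_toSimpleGraph (hF : F ⊆ (contraction Rᶜ).edgeSet) :
    Sym2.map Subtype.val '' ((contraction Rᶜ).restrict F).toSimpleGraph.edgeSet =
      ends R '' F := by
  ext e
  constructor
  · rintro ⟨f, hf, rfl⟩
    induction f using Sym2.ind with
    | h u v =>
      obtain ⟨_, e, he⟩ := hf
      exact ⟨e, (isLink_restrict_iff.1 he).1, ends_eq_of_isLink he⟩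
  · rintro ⟨e, he, rfl⟩
    induction h : ends R e using Sym2.ind with
    | h X Y =>
      have hl := isLink_of_ends_eq hF he h
      refine ⟨s(⟨X, hl.left_mem⟩, ⟨Y, hl.right_mem⟩), ⟨?_, e, hl⟩, rfl⟩
      obtain ⟨_, W, i, hi, _, rfl, rfl⟩ := isLink_restrict_iff.1 hl
      exact fun h' => sdiff_compl_ne_shift_sdiff_compl hi W (congrArg Subtype.val h')

theorem ncard_edgeSet_toSimpleGraph (hF : F ⊆ (contraction Rᶜ).edgeSet) :
    ((contraction Rᶜ).restrict F).toSimpleGraph.edgeSet.ncard = (ends R '' F).ncard := by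
  rw [← image_edgeSet_toSimpleGraph hF,
    Set.ncard_image_of_injective _ (Sym2.map.injective Subtype.val_injective)]

theorem natCard_vertexSet_restrict :
    Nat.card ((contraction Rᶜ).restrict F).vertexSet = 2 ^ R.card := by
  have : ((contraction Rᶜ).restrict F).vertexSet = ((R.powerset : Finset _) : Set _) := by
    ext X
    have : Disjoint X Rᶜ ↔ X ⊆ R := disjoint_compl_right_iff
    simpa [contraction, Graph.restrict] using this
  rw [Nat.card_coe_set_eq, this, Set.ncard_coe_finset, Finset.card_powerset]

theorem connected_iff_connects (hF : F ⊆ (contraction Rᶜ).edgeSet) :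
    ((contraction Rᶜ).restrict F).toSimpleGraph.Connected ↔ Connects F R := by
  have hV : ∀ X : Finset (Fin n), X \ Rᶜ ∈ ((contraction Rᶜ).restrict F).vertexSet :=
    fun X => Finset.sdiff_disjoint
  have hval : ∀ u : ((contraction Rᶜ).restrict F).vertexSet, u.1 \ Rᶜ = u.1 := fun u =>
    Finset.sdiff_eq_self_of_disjoint u.2
  constructor
  · intro hc P hP hP' X Y hX
    obtain ⟨w⟩ := hc.preconnected ⟨_, hV X⟩ ⟨_, hV Y⟩
    have key : ∀ u v, ((contraction Rᶜ).restrict F).toSimpleGraph.Walk u v → P u.1 → P v.1 := by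
      intro u v w
      induction w with
      | nil => exact id
      | cons h _ ih =>
        intro hu
        refine ih ?_
        obtain ⟨_, e, he⟩ := h
        obtain ⟨heF, W, i, _, rfl, h1, h2⟩ := isLink_restrict_iff.1 he
        have hW : P W := hP _ _ (by rw [h1, sdiff_idem]) hu
        exact hP _ _ (by rw [h2, sdiff_idem]) (hP' _ _ heF hW)
    exact hP _ _ (by simp) (key _ _ w (hP _ _ (by simp) hX))
  · intro hc
    refine { preconnected := ?_, nonempty := ⟨⟨_, hV ∅⟩⟩ }
    intro u v
    have := hc (fun X => ((contraction Rᶜ).restrict F).toSimpleGraph.Reachable u ⟨_, hV X⟩)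
      (fun X Y h hX => by
        have : (⟨_, hV X⟩ : ((contraction Rᶜ).restrict F).vertexSet) = ⟨_, hV Y⟩ :=
          Subtype.ext h
        exact this ▸ hX)
      (fun X Y h hX => by
        refine hX.trans (SimpleGraph.Adj.reachable ?_)
        have hl := isLink_of_ends_eq hF h (X := X \ Rᶜ) (Y := Y \ Rᶜ) (by simp [ends])
        refine ⟨fun h' => ?_, _, hl⟩
        obtain ⟨_, W, i, hi, _, h1, h2⟩ := isLink_restrict_iff.1 hl
        exact sdiff_compl_ne_shift_sdiff_compl hi W
          (h1.symm.trans ((congrArg Subtype.val h').trans h2)))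
      u.1 v.1
    have h1 : ∀ u : ((contraction Rᶜ).restrict F).vertexSet,
        (⟨_, hV u.1⟩ : ((contraction Rᶜ).restrict F).vertexSet) = u := fun u =>
      Subtype.ext (hval u)
    rw [h1, h1] at this
    exact this (SimpleGraph.Reachable.refl _)

theorem isTree_restrict_iff (hF : F ⊆ (contraction Rᶜ).edgeSet) :
    IsTree ((contraction Rᶜ).restrict F) ↔ Connects F R ∧ F.ncard + 1 = 2 ^ R.card := by
  rw [IsTree, SimpleGraph.isTree_iff_connected_and_card, natCard_vertexSet_restrict,
    connected_iff_connects hF, simple_restrict_iff hF, Nat.card_coe_set_eq,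
    ncard_edgeSet_toSimpleGraph hF]
  constructor
  · rintro ⟨h1, h2, h3⟩
    exact ⟨h2, by rw [← h3, h1.ncard_image]⟩
  · rintro ⟨h2, h3⟩
    -- Connectivity forces at least `2 ^ R.card - 1` distinct pairs of endpoints, and `F` has only
    -- that many edges, so no two of them are parallel.
    have h4 := ((connected_iff_connects hF).2 h2).card_vert_le_card_edgeSet_add_one
    rw [natCard_vertexSet_restrict, Nat.card_coe_set_eq, ncard_edgeSet_toSimpleGraph hF] at h4
    have h5 : (ends R '' F).ncard ≤ F.ncard := Set.ncard_image_le (Set.toFinite F)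
    have h6 : (ends R '' F).ncard = F.ncard := by omega
    exact ⟨Set.injOn_of_ncard_image_eq h6, h2, by omega⟩

theorem injOn_ends_of_isTree (hF : F ⊆ (contraction Rᶜ).edgeSet)
    (h : IsTree ((contraction Rᶜ).restrict F)) : Set.InjOn (ends R) F :=
  (simple_restrict_iff hF).1 h.1

end Criterion

/-- Viewing the cube as the contraction of no directions lets one tree criterion serve both sides of
the isomorphism. -/
theorem cubeGraph_eq_contraction (n : ℕ) :
    cubeGraph n = contraction (Finset.univ : Finset (Fin n))ᶜ := by
  have key : ∀ X Y : Finset (Fin n), (cube n).Adj X Y ↔ ∃ i, Y = shift i X := fun X Y => by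
    simp only [cube, Finset.card_eq_one, shift]
    refine exists_congr fun i => ?_
    rw [← symmDiff_right_inj (a := X), symmDiff_symmDiff_cancel_left]
  refine Graph.ext (by ext; simp [cubeGraph, contraction]) fun e X Y => ?_
  simp only [cubeGraph, Graph.ofSimpleGraph, contraction]
  constructor
  · rintro ⟨rfl, h⟩
    obtain ⟨i, hi⟩ : ∃ i, Y = shift i X := (key _ _).1 h
    subst hi
    exact ⟨X, i, by simp⟩
  · rintro ⟨W, i, _, rfl, h1, h2⟩
    simp only [Finset.compl_univ, Finset.sdiff_empty] at h1 h2
    subst h1 h2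
    exact ⟨rfl, (key _ _).2 ⟨i, rfl⟩⟩

/-! ### Restricting a tree to a set of directions -/

/-- The edges of `F` in a direction belonging to `R`. -/
def dirPart {n : ℕ} (F : Set (Edge n)) (R : Finset (Fin n)) : Set (Edge n) :=
  {e | e ∈ F ∧ ∃ i ∈ R, HasDir e i}

/-- `F` is the edge set of a spanning tree of `Q_n / Rᶜ`. -/
def Spans {n : ℕ} (R : Finset (Fin n)) (F : Set (Edge n)) : Prop :=
  F ⊆ (contraction Rᶜ).edgeSet ∧ IsTree ((contraction Rᶜ).restrict F)

theorem subset_edgeSet_contraction_iff {n : ℕ} {R : Finset (Fin n)} {F : Set (Edge n)} :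
    F ⊆ (contraction Rᶜ).edgeSet ↔ ∀ e ∈ F, ∃ i ∈ R, HasDir e i := by
  simp [contraction, Set.subset_def]

theorem spans_iff {n : ℕ} {R : Finset (Fin n)} {F : Set (Edge n)} :
    Spans R F ↔ (∀ e ∈ F, ∃ i ∈ R, HasDir e i) ∧ Connects F R ∧ F.ncard + 1 = 2 ^ R.card := by
  rw [Spans, ← subset_edgeSet_contraction_iff]
  exact and_congr_right fun h => isTree_restrict_iff h

theorem spans_univ_iff {n : ℕ} {F : Set (Edge n)} :
    Spans Finset.univ F ↔ F ⊆ (cubeGraph n).edgeSet ∧ IsTree ((cubeGraph n).restrict F) := by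
  rw [Spans, cubeGraph_eq_contraction]

theorem ncard_dirPart {n : ℕ} (F : Set (Edge n)) (R : Finset (Fin n)) :
    (dirPart F R).ncard = ∑ i ∈ R, {e : Edge n | e ∈ F ∧ HasDir e i}.ncard := by
  classical
  have h : dirPart F R =
      ((R.biUnion fun i => (Set.toFinite {e : Edge n | e ∈ F ∧ HasDir e i}).toFinset :
        Finset (Edge n)) : Set (Edge n)) := by
    ext e
    simp [dirPart]
  rw [h, Set.ncard_coe_finset, Finset.card_biUnion]
  · exact Finset.sum_congr rfl fun i _ => (Set.ncard_eq_toFinset_card _ _).symm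
  · intro i _ j _ hij
    refine Finset.disjoint_left.2 ?_
    intro e h1 h2
    simp only [Set.Finite.mem_toFinset, Set.mem_ofPred_eq] at h1 h2
    exact hij (h1.2.unique h2.2)

/-- An edge in a direction outside `R` joins two vertices that the contraction identifies, so
dropping it costs no connectivity. -/
theorem Connects.dirPart {n : ℕ} {F : Set (Edge n)} (hF : ∀ e ∈ F, ∃ i, HasDir e i)
    (h : Connects F Finset.univ) (R : Finset (Fin n)) : Connects (dirPart F R) R := by
  intro P hP hP'
  refine h P (fun X Y hXY => hP X Y (by simp_all)) fun X Y hXY => ?_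
  obtain ⟨i, W, hW⟩ := hF _ hXY
  by_cases hi : i ∈ R
  · exact hP' X Y ⟨hXY, i, hi, W, hW⟩
  · refine hP X Y ?_
    have := shift_sdiff_compl_of_notMem hi W
    rcases Sym2.eq_iff.1 hW with ⟨rfl, rfl⟩ | ⟨rfl, rfl⟩
    · exact this.symm
    · exact this

/-! ### Initial directions and the arithmetic of saturation -/

theorem mem_firstDirs {n k : ℕ} {i : Fin n} : i ∈ firstDirs n k ↔ (i : ℕ) < k := by
  simp [firstDirs]

theorem card_firstDirs {n k : ℕ} (hk : k ≤ n) : (firstDirs n k).card = k := by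
  rw [firstDirs, Fin.card_filter_val_lt, min_eq_right hk]

theorem firstDirs_self (n : ℕ) : firstDirs n n = Finset.univ := by
  ext i
  simp [mem_firstDirs]

theorem sdiff_compl_firstDirs_eq_iff {n m : ℕ} {X Y : Finset (Fin n)} :
    X \ (firstDirs n m)ᶜ = Y \ (firstDirs n m)ᶜ ↔ ∀ i : Fin n, (i : ℕ) < m → (i ∈ X ↔ i ∈ Y) := by
  simp only [Finset.ext_iff, Finset.mem_sdiff, Finset.mem_compl, not_not, mem_firstDirs]
  exact forall_congr' fun i => by tauto

theorem sum_firstDirs_succ {n k : ℕ} (hk : k < n) (a : Fin n → ℕ) :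
    ∑ i ∈ firstDirs n (k + 1), a i = ∑ i ∈ firstDirs n k, a i + a ⟨k, hk⟩ := by
  have : firstDirs n (k + 1) = insert ⟨k, hk⟩ (firstDirs n k) := by
    ext i
    simp only [mem_firstDirs, Finset.mem_insert, Fin.ext_iff]
    omega
  rw [this, Finset.sum_insert (by simp [mem_firstDirs]), add_comm]

/-- Exchange argument: `L \ K` and `K \ L` have the same size, and every direction in the first lies
below every direction in the second. Hence the minimum in the excess is attained at the initial
directions. -/
theorem sum_firstDirs_le {n : ℕ} {a : Fin n → ℕ} (ha : Monotone a) (K : Finset (Fin n)) :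
    ∑ i ∈ firstDirs n K.card, a i ≤ ∑ i ∈ K, a i := by
  have hK : K.card ≤ n := by simpa using K.card_le_univ
  have hc := card_firstDirs hK
  set L := firstDirs n K.card
  have hcard : (L \ K).card = (K \ L).card := by
    have h1 := Finset.card_sdiff_add_card_inter L K
    have h2 := Finset.card_sdiff_add_card_inter K L
    rw [Finset.inter_comm] at h2
    omega
  have key : ∑ i ∈ L \ K, a i ≤ ∑ i ∈ K \ L, a i := by
    rcases (K \ L).eq_empty_or_nonempty with h | h
    · rw [h, Finset.card_empty, Finset.card_eq_zero] at hcard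
      rw [h, hcard]
    · obtain ⟨m, hm, hmin⟩ := Finset.exists_min_image _ a h
      calc ∑ i ∈ L \ K, a i ≤ (L \ K).card • a m := by
            refine Finset.sum_le_card_nsmul _ _ _ fun i hi => ha ?_
            have h1 := mem_firstDirs.1 (Finset.mem_sdiff.1 hi).1
            have h2 := mt mem_firstDirs.2 (Finset.mem_sdiff.1 hm).2
            exact Fin.le_def.2 (by omega)
        _ = (K \ L).card • a m := by rw [hcard]
        _ ≤ ∑ i ∈ K \ L, a i := Finset.card_nsmul_le_sum _ _ _ fun i hi => hmin i hi
  rw [← Finset.sum_sdiff (Finset.inter_subset_left (s₁ := L) (s₂ := K)),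
    ← Finset.sum_sdiff (Finset.inter_subset_right (s₁ := L) (s₂ := K)),
    Finset.sdiff_inter_self_left, Finset.sdiff_inter_self_right]
  omega

theorem SaturatedAbove.sum_firstDirs {n r k : ℕ} {a : Fin n → ℕ} (ha : Monotone a)
    (hs : SaturatedAbove a r) (hr : r ≤ k) (hk : k ≤ n) :
    ∑ i ∈ firstDirs n k, a i + 1 = 2 ^ k := by
  have hmin : sInf {s : ℕ | ∃ K : Finset (Fin n), K.card = k ∧ s = ∑ i ∈ K, a i} =
      ∑ i ∈ firstDirs n k, a i := by
    refine IsLeast.csInf_eq ⟨⟨_, card_firstDirs hk, rfl⟩, ?_⟩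
    rintro _ ⟨K, rfl, rfl⟩
    exact sum_firstDirs_le ha K
  have h := hs k hr hk
  rw [excess, hmin] at h
  zify
  push_cast at h
  linarith

theorem SaturatedAbove.apply {n r : ℕ} {a : Fin n → ℕ} (ha : Monotone a)
    (hs : SaturatedAbove a r) (k : Fin n) (hr : r ≤ k) : a k = 2 ^ (k : ℕ) := by
  have h1 := hs.sum_firstDirs ha hr k.2.le
  have h2 := hs.sum_firstDirs ha (Nat.le_succ_of_le hr) k.2
  rw [Nat.succ_eq_add_one, sum_firstDirs_succ k.2, pow_succ] at h2
  simp only [Fin.eta] at h2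
  omega

/-! ### One edge over each set of lower directions -/

/-- `F` contains, for each `X` contained in the directions below `k`, exactly one edge of
direction `k` lying over `X`. -/
structure Selective {n : ℕ} (F : Set (Edge n)) (k : Fin n) : Prop where
  exists_mem : ∀ X : Finset (Fin n), ∃ W, s(W, shift k W) ∈ F ∧ ∀ i < k, i ∈ W ↔ i ∈ X
  unique : ∀ W W' : Finset (Fin n), s(W, shift k W) ∈ F → s(W', shift k W') ∈ F →
    (∀ i < k, i ∈ W ↔ i ∈ W') → ∀ l, k < l → (l ∈ W ↔ l ∈ W')

theorem mk_shift_shift {n : ℕ} (k : Fin n) (W : Finset (Fin n)) :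
    (s(shift k W, shift k (shift k W)) : Edge n) = s(W, shift k W) := by
  rw [shift_shift, Sym2.eq_swap]

theorem exists_notMem_mk_shift_eq {n : ℕ} (k : Fin n) (W : Finset (Fin n)) :
    ∃ V : Finset (Fin n), k ∉ V ∧ (s(V, shift k V) : Edge n) = s(W, shift k W) ∧
      ∀ i, i ≠ k → (i ∈ V ↔ i ∈ W) := by
  by_cases h : k ∈ W
  · refine ⟨shift k W, by simp [mem_shift, h], mk_shift_shift k W, fun i hi => ?_⟩
    simp [mem_shift, hi]
  · exact ⟨W, h, rfl, fun _ _ => Iff.rfl⟩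

/-- Each edge in direction `k` is represented by its endpoint avoiding `k`, which removes the
ambiguity between its two endpoints. -/
theorem ncard_hasDir_eq {n : ℕ} (F : Set (Edge n)) (k : Fin n) :
    {e : Edge n | e ∈ F ∧ HasDir e k}.ncard =
      {W : Finset (Fin n) | k ∉ W ∧ s(W, shift k W) ∈ F}.ncard := by
  have : {e : Edge n | e ∈ F ∧ HasDir e k} = (fun W : Finset (Fin n) => s(W, shift k W)) ''
      {W : Finset (Fin n) | k ∉ W ∧ s(W, shift k W) ∈ F} := by
    ext e
    constructor
    · rintro ⟨he, W, rfl⟩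
      obtain ⟨V, hV, hVW, _⟩ := exists_notMem_mk_shift_eq k W
      exact ⟨V, ⟨hV, by rwa [hVW]⟩, hVW⟩
    · rintro ⟨W, ⟨_, hW⟩, rfl⟩
      exact ⟨hW, W, rfl⟩
  rw [this, Set.InjOn.ncard_image]
  rintro W ⟨hW, _⟩ V ⟨hV, _⟩ h
  rcases (mk_shift_eq_mk_shift_iff.1 h).2 with h | h
  · exact h
  · rw [h, mem_shift] at hW
    simp [hV] at hW

theorem firstDirs_inter_eq_iff {n : ℕ} {k : Fin n} {V W : Finset (Fin n)} :
    firstDirs n k ∩ V = firstDirs n k ∩ W ↔ ∀ i < k, i ∈ V ↔ i ∈ W := by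
  simp only [Finset.ext_iff, Finset.mem_inter, mem_firstDirs, Fin.val_fin_lt]
  exact forall_congr' fun i => by tauto

theorem Selective.ncard_hasDir {n : ℕ} {F : Set (Edge n)} {k : Fin n} (h : Selective F k) :
    {e : Edge n | e ∈ F ∧ HasDir e k}.ncard = 2 ^ (k : ℕ) := by
  rw [ncard_hasDir_eq, ← card_firstDirs k.2.le, ← Finset.card_powerset, ← Set.ncard_coe_finset]
  refine Set.ncard_congr (fun W _ => firstDirs n k ∩ W) ?_ ?_ ?_
  · intro W _
    simp
  · rintro V W ⟨hV, hV'⟩ ⟨hW, hW'⟩ hVW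
    have h1 := firstDirs_inter_eq_iff.1 hVW
    ext l
    rcases lt_trichotomy l k with hl | rfl | hl
    · exact h1 l hl
    · simp [hV, hW]
    · exact h.unique V W hV' hW' h1 l hl
  · intro X hX
    obtain ⟨W, hW, hWX⟩ := h.exists_mem X
    obtain ⟨V, hV, hVW, hVi⟩ := exists_notMem_mk_shift_eq k W
    refine ⟨V, ⟨hV, by rwa [hVW]⟩, ?_⟩
    rw [← Finset.inter_eq_right.2 (Finset.mem_powerset.1 (Finset.mem_coe.1 hX)),
      firstDirs_inter_eq_iff]
    exact fun i hi => (hVi i hi.ne).trans (hWX i hi)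

/-- Pigeonhole: two edges in direction `k` that agree below `k` would be parallel in the
contraction, so the edges inject into the subsets of the lower directions. There are `2 ^ k` of
each, so every subset is hit. -/
theorem selective_of_injOn {n : ℕ} {F : Set (Edge n)} {k : Fin n}
    (hinj : Set.InjOn (ends (firstDirs n (k + 1))) (dirPart F (firstDirs n (k + 1))))
    (hcard : {e : Edge n | e ∈ F ∧ HasDir e k}.ncard = 2 ^ (k : ℕ)) : Selective F k := by
  have huniq : ∀ W W' : Finset (Fin n), k ∉ W → k ∉ W' → s(W, shift k W) ∈ F →
      s(W', shift k W') ∈ F → (∀ i < k, i ∈ W ↔ i ∈ W') → W = W' := by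
    intro W W' hkW hkW' hW hW' h
    have hd : ∀ {V : Finset (Fin n)}, s(V, shift k V) ∈ F →
        s(V, shift k V) ∈ dirPart F (firstDirs n (k + 1)) := fun {V} hV =>
      ⟨hV, k, by simp [mem_firstDirs], V, rfl⟩
    have hi : ∀ i : Fin n, (i : ℕ) < k + 1 → (i ∈ W ↔ i ∈ W') := by
      intro i hi
      rcases (Nat.lt_succ_iff_lt_or_eq.1 hi) with hi | hi
      · exact h i hi
      · obtain rfl := Fin.ext hi
        simp [hkW, hkW']
    have h1 := hinj (hd hW) (hd hW') (by
      simp only [ends, Sym2.map_mk]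
      rw [sdiff_compl_firstDirs_eq_iff.2 hi,
        sdiff_compl_firstDirs_eq_iff (X := shift k W) (Y := shift k W') |>.2 fun i h => by
          simp only [mem_shift, hi i h]])
    rcases (mk_shift_eq_mk_shift_iff.1 h1).2 with h | h
    · exact h
    · rw [h, mem_shift] at hkW
      simp [hkW'] at hkW
  have himg : (fun W => firstDirs n k ∩ W) ''
      {W : Finset (Fin n) | k ∉ W ∧ s(W, shift k W) ∈ F} =
        ((firstDirs n k).powerset : Set (Finset (Fin n))) := by
    refine Set.eq_of_subset_of_ncard_le ?_ ?_
    · rintro _ ⟨W, _, rfl⟩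
      simp
    · rw [Set.InjOn.ncard_image, ← ncard_hasDir_eq, hcard, Set.ncard_coe_finset,
        Finset.card_powerset, card_firstDirs k.2.le]
      rintro W ⟨h1, h2⟩ W' ⟨h1', h2'⟩ h
      exact huniq W W' h1 h1' h2 h2' (firstDirs_inter_eq_iff.1 h)
  constructor
  · intro X
    obtain ⟨W, ⟨_, hW⟩, h⟩ := himg.ge (show firstDirs n k ∩ X ∈ _ by simp)
    exact ⟨W, hW, firstDirs_inter_eq_iff.1 h⟩
  · intro W W' hW hW' h l hl
    obtain ⟨V, hkV, hV, hVW⟩ := exists_notMem_mk_shift_eq k W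
    obtain ⟨V', hkV', hV', hVW'⟩ := exists_notMem_mk_shift_eq k W'
    rw [← hVW l hl.ne', ← hVW' l hl.ne', huniq V V' hkV hkV' (hV ▸ hW) (hV' ▸ hW') fun i hi => by
      rw [hVW i hi.ne, hVW' i hi.ne, h i hi]]

/-- A class closed under `F` and under agreement up to `k` is also closed under `shift k`, because
an edge of `F` in direction `k` lies over every lower set. It is therefore closed under agreement
below `k`, where connectivity is known. -/
theorem Connects.firstDirs_succ {n : ℕ} {F : Set (Edge n)} {k : Fin n}
    (h : Connects F (firstDirs n k)) (hk : Selective F k) : Connects F (firstDirs n (k + 1)) := by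
  intro P hP hP'
  have hP1 : ∀ X Y : Finset (Fin n), (∀ i ≤ k, i ∈ X ↔ i ∈ Y) → P X → P Y := by
    intro X Y hXY
    exact hP X Y (sdiff_compl_firstDirs_eq_iff.2 fun i hi => hXY i (Nat.lt_succ_iff.1 hi))
  have hshift : ∀ X : Finset (Fin n), P X → P (shift k X) := by
    intro X hX
    obtain ⟨W, hW, hWX⟩ := hk.exists_mem X
    -- This decides which endpoint of the edge `X` agrees with up to `k`; the edge is crossed from
    -- that endpoint.
    by_cases hkX : k ∈ X ↔ k ∈ W
    · refine hP1 (shift k W) _ (fun i hi => ?_) (hP' W _ hW (hP1 X W (fun i hi => ?_) hX))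
      · rcases hi.lt_or_eq with hi | rfl
        · simp [mem_shift, hWX i hi]
        · simp [mem_shift, hkX]
      · rcases hi.lt_or_eq with hi | rfl
        · exact (hWX i hi).symm
        · exact hkX
    · refine hP1 W _ (fun i hi => ?_) (hP' (shift k W) W (by rwa [Sym2.eq_swap])
        (hP1 X (shift k W) (fun i hi => ?_) hX))
      · rcases hi.lt_or_eq with hi | rfl
        · simp [mem_shift, hWX i hi, hi.ne]
        · simp only [mem_shift]; tauto
      · rcases hi.lt_or_eq with hi | rfl
        · simp [mem_shift, hWX i hi, hi.ne]
        · simp only [mem_shift]; tauto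
  refine h P (fun X Y hXY hX => ?_) hP'
  have hXY' : ∀ i < k, i ∈ X ↔ i ∈ Y := fun i hi => sdiff_compl_firstDirs_eq_iff.1 hXY i hi
  by_cases hkX : k ∈ X ↔ k ∈ Y
  · refine hP1 X Y (fun i hi => ?_) hX
    rcases hi.lt_or_eq with hi | rfl
    · exact hXY' i hi
    · exact hkX
  · refine hP1 (shift k X) Y (fun i hi => ?_) (hshift X hX)
    rcases hi.lt_or_eq with hi | rfl
    · simp [mem_shift, hXY' i hi, hi.ne]
    · simp only [mem_shift]; tauto

/-! ### Spanning trees with a saturated signature -/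

section Saturated

variable {n r : ℕ} {a : Fin n → ℕ} {F : Set (Edge n)}

theorem Spans.dirPart (hF : Spans Finset.univ F)
    (hsig : ∀ i, {e : Edge n | e ∈ F ∧ HasDir e i}.ncard = a i) {k : ℕ} (hk : k ≤ n)
    (ha : ∑ i ∈ firstDirs n k, a i + 1 = 2 ^ k) :
    Spans (firstDirs n k) (dirPart F (firstDirs n k)) := by
  obtain ⟨h1, h2, _⟩ := spans_iff.1 hF
  refine spans_iff.2 ⟨fun e he => he.2, h2.dirPart (fun e he => ?_) _, ?_⟩
  · obtain ⟨i, _, hi⟩ := h1 e he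
    exact ⟨i, hi⟩
  · rw [ncard_dirPart, card_firstDirs hk, ← ha]
    simp_rw [hsig]

theorem Spans.selective (ha : Monotone a) (hs : SaturatedAbove a r) (hF : Spans Finset.univ F)
    (hsig : ∀ i, {e : Edge n | e ∈ F ∧ HasDir e i}.ncard = a i) (k : Fin n) (hk : r ≤ k) :
    Selective F k := by
  have h := hF.dirPart hsig (k := k + 1) k.2 (hs.sum_firstDirs ha (by omega) k.2)
  exact selective_of_injOn (injOn_ends_of_isTree h.1 h.2) ((hsig k).trans (hs.apply ha k hk))

theorem spans_univ_of_selective (hs : ∑ i, a i + 1 = 2 ^ n) (hrn : r ≤ n)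
    (hdir : ∀ e ∈ F, ∃ i, HasDir e i)
    (hF : Connects F (firstDirs n r)) (hsel : ∀ k : Fin n, r ≤ k → Selective F k)
    (hsig : ∀ i, {e : Edge n | e ∈ F ∧ HasDir e i}.ncard = a i) : Spans Finset.univ F := by
  refine spans_iff.2 ⟨by simpa using hdir, ?_, ?_⟩
  · rw [← firstDirs_self]
    have : ∀ k, r ≤ k → k ≤ n → Connects F (firstDirs n k) := by
      intro k hk
      induction k, hk using Nat.le_induction with
      | base => exact fun _ => hF
      | succ k hk ih => exact fun hn => (ih (by omega)).firstDirs_succ (k := ⟨k, hn⟩) (hsel _ hk)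
    exact this n hrn le_rfl
  · have h1 : dirPart F Finset.univ = F := by
      ext e
      simpa [EdgeSlide.dirPart] using hdir e
    rw [← h1, ncard_dirPart, Finset.card_univ, Fintype.card_fin, ← hs]
    simp_rw [hsig]

end Saturated

/-! ### Encoding the edges in high directions by bits -/

/-- The graph on the subsets of `J` in which two subsets are adjacent iff they differ in exactly
one element. -/
def flipGraph (J : Type*) : SimpleGraph (Set J) where
  Adj P Q := ∃ j, ∀ i, (i ∈ P ↔ i ∈ Q) ↔ i ≠ j
  symm := ⟨fun P Q ⟨j, hj⟩ => ⟨j, fun i => by rw [← hj i]; exact iff_comm⟩⟩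
  loopless := ⟨fun P ⟨j, hj⟩ => (hj j).1 Iff.rfl rfl⟩

/-- The triples consisting of a direction `k ≥ r`, a set of directions below `k`, and a direction
above `k`. -/
abbrev BitIndex (n r : ℕ) : Type :=
  {p : Fin n × Finset (Fin n) × Fin n // r ≤ p.1 ∧ p.2.1 ⊆ firstDirs n p.1 ∧ p.1 < p.2.2}

/-- The index made of the direction `k`, the elements of `W` below `k`, and the direction `l`. -/
def bitIndex {n r : ℕ} (k : Fin n) (hk : r ≤ k) (W : Finset (Fin n)) (l : Fin n) (hl : k < l) :
    BitIndex n r :=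
  ⟨(k, firstDirs n k ∩ W, l), hk, Finset.inter_subset_left, hl⟩

theorem bitIndex_congr {n r : ℕ} {k : Fin n} (hk : r ≤ k) {W V : Finset (Fin n)}
    {l : Fin n} (hl : k < l) (h : ∀ i < k, i ∈ W ↔ i ∈ V) :
    bitIndex k hk W l hl = bitIndex k hk V l hl := by
  rw [bitIndex, bitIndex, Subtype.mk.injEq, firstDirs_inter_eq_iff.2 h]

theorem bitIndex_eq_iff {n r : ℕ} {k k' : Fin n} {hk : r ≤ k} {hk' : r ≤ k'}
    {W V : Finset (Fin n)} {l l' : Fin n} {hl : k < l} {hl' : k' < l'} :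
    bitIndex k hk W l hl = bitIndex k' hk' V l' hl' ↔
      k = k' ∧ l = l' ∧ ∀ i < k, i ∈ W ↔ i ∈ V := by
  rw [bitIndex, bitIndex, Subtype.mk.injEq, Prod.mk.injEq, Prod.mk.injEq]
  constructor
  · rintro ⟨rfl, h, rfl⟩
    exact ⟨rfl, rfl, firstDirs_inter_eq_iff.1 h⟩
  · rintro ⟨rfl, rfl, h⟩
    exact ⟨rfl, firstDirs_inter_eq_iff.2 h, rfl⟩

theorem exists_eq_bitIndex {n r : ℕ} (p : BitIndex n r) :
    ∃ (k : Fin n) (hk : r ≤ k) (W : Finset (Fin n)) (l : Fin n) (hl : k < l),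
      p = bitIndex k hk W l hl := by
  obtain ⟨⟨k, X, l⟩, hk, hX, hl⟩ := p
  exact ⟨k, hk, X, l, hl, by simp [bitIndex, Finset.inter_eq_right.2 hX]⟩

/-- The indices `(k, X, l)` such that the edge of `F` in direction `k` over `X` has `l` in its
endpoints. -/
def bits {n : ℕ} (r : ℕ) (F : Set (Edge n)) : Set (BitIndex n r) :=
  {p | ∃ W : Finset (Fin n), s(W, shift p.1.1 W) ∈ F ∧ firstDirs n p.1.1 ∩ W = p.1.2.1 ∧
    p.1.2.2 ∈ W}

/-- The edge set `F` together with the edges in the directions from `r` on described by `P`. -/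
def extend {n r : ℕ} (F : Set (Edge n)) (P : Set (BitIndex n r)) : Set (Edge n) :=
  F ∪ {e | ∃ (k : Fin n) (hk : r ≤ k) (W : Finset (Fin n)), e = s(W, shift k W) ∧
    ∀ l (hl : k < l), bitIndex k hk W l hl ∈ P ↔ l ∈ W}

section Bits

variable {n r : ℕ} {F : Set (Edge n)}

theorem bitIndex_mem_bits {k : Fin n} (hF : Selective F k) (hk : r ≤ k) {W : Finset (Fin n)}
    (hW : s(W, shift k W) ∈ F) {l : Fin n} (hl : k < l) :
    bitIndex k hk W l hl ∈ bits r F ↔ l ∈ W := by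
  constructor
  · rintro ⟨V, hV, hVW, hlV⟩
    exact (hF.unique V W hV hW (firstDirs_inter_eq_iff.1 hVW) l hl).1 hlV
  · exact fun h => ⟨W, hW, rfl, h⟩

theorem mk_shift_eq_of_forall {k : Fin n} {V W : Finset (Fin n)}
    (h : ∀ i, i ≠ k → (i ∈ V ↔ i ∈ W)) : (s(V, shift k V) : Edge n) = s(W, shift k W) := by
  refine mk_shift_eq_mk_shift_iff.2 ⟨rfl, ?_⟩
  by_cases hk : k ∈ V ↔ k ∈ W
  · left
    ext i
    by_cases hi : i = k
    · exact hi ▸ hk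
    · exact h i hi
  · right
    ext i
    rw [mem_shift]
    by_cases hi : i = k
    · subst hi; tauto
    · simp [hi, h i hi]

theorem Selective.mk_shift_eq {k : Fin n} (hF : Selective F k) {V W : Finset (Fin n)}
    (hV : s(V, shift k V) ∈ F) (hW : s(W, shift k W) ∈ F) (h : ∀ i < k, i ∈ V ↔ i ∈ W) :
    (s(V, shift k V) : Edge n) = s(W, shift k W) :=
  mk_shift_eq_of_forall fun i hi => hi.lt_or_gt.elim (h i) (hF.unique V W hV hW h i)

/-- The edge that `F` has over the lower part of `W` is pinned down by its bits; if `W` has the same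
bits, the two edges differ at most in which endpoint names them. -/
theorem mk_shift_mem_iff_bits {k : Fin n} (hF : Selective F k) (hk : r ≤ k)
    {W : Finset (Fin n)} : s(W, shift k W) ∈ F ↔
      ∀ l (hl : k < l), bitIndex k hk W l hl ∈ bits r F ↔ l ∈ W := by
  constructor
  · exact fun hW l hl => bitIndex_mem_bits hF hk hW hl
  · intro h
    obtain ⟨V, hV, hVW⟩ := hF.exists_mem W
    rwa [← mk_shift_eq_of_forall (V := V) fun i hi => hi.lt_or_gt.elim (hVW i) fun hl => by
      rw [← h i hl, ← bitIndex_congr hk hl hVW, bitIndex_mem_bits hF hk hV]]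

theorem mk_shift_mem_extend_iff {P : Set (BitIndex n r)}
    (hF : ∀ e ∈ F, ∃ i ∈ firstDirs n r, HasDir e i) {k : Fin n} (hk : r ≤ k)
    {W : Finset (Fin n)} : s(W, shift k W) ∈ extend F P ↔
      ∀ l (hl : k < l), bitIndex k hk W l hl ∈ P ↔ l ∈ W := by
  constructor
  · rintro (h | ⟨k', hk', V, h, hV⟩)
    · obtain ⟨i, hi, hi'⟩ := hF _ h
      rw [mem_firstDirs, hi'.unique ⟨W, rfl⟩] at hi
      omega
    · obtain ⟨rfl, hVW⟩ := mk_shift_eq_mk_shift_iff.1 h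
      -- The choice of endpoint is harmless: neither the index nor the bit looks at `k` itself.
      have hVW' : ∀ i, i ≠ k → (i ∈ W ↔ i ∈ V) := by
        rcases hVW with rfl | rfl
        · simp
        · intro i hi
          simp [mem_shift, hi]
      intro l hl
      rw [hVW' l hl.ne', ← hV l hl, bitIndex_congr hk hl fun i hi => hVW' i hi.ne]
  · exact fun h => Or.inr ⟨k, hk, W, rfl, h⟩

theorem selective_extend (P : Set (BitIndex n r))
    (hF : ∀ e ∈ F, ∃ i ∈ firstDirs n r, HasDir e i) {k : Fin n} (hk : r ≤ k) :
    Selective (extend F P) k := by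
  classical
  constructor
  · intro X
    -- The witness copies `X` below `k`, reads the bits of `P` above `k`, and omits `k`.
    refine ⟨Finset.univ.filter fun i => (i < k ∧ i ∈ X) ∨
      ∃ h : k < i, bitIndex k hk X i h ∈ P, ?_, ?_⟩
    · rw [mk_shift_mem_extend_iff hF hk]
      intro l hl
      rw [bitIndex_congr (V := X) hk hl fun i hi => ?_]
      · simp [hl, hl.not_gt]
      · simp [hi, hi.not_gt]
    · intro i hi
      simp [hi, hi.not_gt]
  · intro V W hV hW hVW l hl
    rw [mk_shift_mem_extend_iff hF hk] at hV hW
    rw [← hV l hl, ← hW l hl, bitIndex_congr hk hl hVW]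

theorem bits_extend (P : Set (BitIndex n r))
    (hF : ∀ e ∈ F, ∃ i ∈ firstDirs n r, HasDir e i) : bits r (extend F P) = P := by
  ext p
  obtain ⟨k, hk, X, l, hl, rfl⟩ := exists_eq_bitIndex p
  obtain ⟨W, hW, hWX⟩ := (selective_extend P hF hk).exists_mem X
  rw [← bitIndex_congr hk hl hWX, bitIndex_mem_bits (selective_extend P hF hk) hk hW,
    (mk_shift_mem_extend_iff hF hk).1 hW l hl]

theorem dirPart_extend (P : Set (BitIndex n r))
    (hF : ∀ e ∈ F, ∃ i ∈ firstDirs n r, HasDir e i) :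
    dirPart (extend F P) (firstDirs n r) = F := by
  ext e
  constructor
  · rintro ⟨h | ⟨k, hk, W, rfl, _⟩, i, hi, hei⟩
    · exact h
    · rw [mem_firstDirs, hei.unique ⟨W, rfl⟩] at hi
      omega
  · exact fun h => ⟨Or.inl h, hF e h⟩

theorem extend_bits (hdir : ∀ e ∈ F, ∃ i, HasDir e i)
    (hF : ∀ k : Fin n, r ≤ k → Selective F k) :
    extend (dirPart F (firstDirs n r)) (bits r F) = F := by
  ext e
  constructor
  · rintro (h | ⟨k, hk, W, rfl, h⟩)
    · exact h.1
    · exact (mk_shift_mem_iff_bits (hF k hk) hk).2 h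
  · intro he
    obtain ⟨k, W, rfl⟩ := hdir e he
    by_cases hk : r ≤ k
    · exact Or.inr ⟨k, hk, W, rfl, (mk_shift_mem_iff_bits (hF k hk) hk).1 he⟩
    · exact Or.inl ⟨he, k, mem_firstDirs.2 (not_le.1 hk), W, rfl⟩

end Bits

/-! ### Edge slides as slides in the contraction or bit flips -/

/-- The relation underlying an edge slide, on edge sets. -/
def SetSlide {n : ℕ} (F₁ F₂ : Set (Edge n)) : Prop :=
  ∃ e ∈ F₁, ∃ i j : Fin n, HasDir e j ∧ j ≠ i ∧ shiftEdge i e ∉ F₁ ∧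
    F₂ = insert (shiftEdge i e) (F₁ \ {e})

theorem shiftEdge_mk_shift {n : ℕ} (i j : Fin n) (W : Finset (Fin n)) :
    shiftEdge i s(W, shift j W) = s(shift i W, shift j (shift i W)) := by
  simp [shiftEdge, shift_comm i j]

section Slide

variable {n r : ℕ} {F₁ F₂ : Set (Edge n)}

theorem SetSlide.dirPart_bits (h₁ : ∀ k : Fin n, r ≤ k → Selective F₁ k)
    (h₂ : ∀ k : Fin n, r ≤ k → Selective F₂ k) (h : SetSlide F₁ F₂) :
    (SetSlide (dirPart F₁ (firstDirs n r)) (dirPart F₂ (firstDirs n r)) ∧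
        bits r F₁ = bits r F₂) ∨
      ((flipGraph (BitIndex n r)).Adj (bits r F₁) (bits r F₂) ∧
        dirPart F₁ (firstDirs n r) = dirPart F₂ (firstDirs n r)) := by
  obtain ⟨e, he, i, j, hej, hji, hne, rfl⟩ := h
  have hej' := hej.shiftEdge i
  by_cases hj : r ≤ j
  · right
    have hdir : dirPart F₁ (firstDirs n r) =
        dirPart (insert (shiftEdge i e) (F₁ \ {e})) (firstDirs n r) := by
      ext f
      refine and_congr_left ?_
      rintro ⟨k, hk, hfk⟩
      rw [mem_firstDirs] at hk
      have h1 : f ≠ e := by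
        rintro rfl
        rw [hej.unique hfk] at hj
        omega
      have h2 : f ≠ shiftEdge i e := by
        rintro rfl
        rw [hej'.unique hfk] at hj
        omega
      simp [h1, h2]
    refine ⟨?_, hdir⟩
    obtain ⟨W, rfl⟩ := hej
    rw [shiftEdge_mk_shift] at *
    have hsel₁ := h₁ j hj
    have hsel₂ := h₂ j hj
    have hij : j < i := by
      -- If `i < j`, the moved edge lies over a different lower set. Then no edge of the new tree
      -- lies over the lower part of `W`: the moved edge differs from it at `i`, and `e` was the
      -- only old edge there.
      refine lt_of_le_of_ne (not_lt.1 fun hij => ?_) hji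
      obtain ⟨V, hV, hVW⟩ := hsel₂.exists_mem W
      rcases hV with hV | ⟨hV, hV'⟩
      · have hi := hVW i hij
        rcases (mk_shift_eq_mk_shift_iff.1 hV).2 with rfl | rfl
        · simp [mem_shift] at hi
        · simp [mem_shift, hji.symm] at hi
      · exact hV' (hsel₁.mk_shift_eq hV he hVW)
    refine ⟨bitIndex j hj W i hij, fun p => ?_⟩
    obtain ⟨k, hk, X, l, hl, rfl⟩ := exists_eq_bitIndex p
    obtain ⟨V, hV, hVX⟩ := (h₁ k hk).exists_mem X
    rw [← bitIndex_congr hk hl hVX, bitIndex_mem_bits (h₁ k hk) hk hV]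
    -- Only indices of the moved edge can change their bit, and among these only the one with `l =
    -- i` does.
    by_cases hVW : (s(V, shift k V) : Edge n) = s(W, shift j W)
    · obtain ⟨rfl, hVW'⟩ := mk_shift_eq_mk_shift_iff.1 hVW
      have hVW' : ∀ i, i ≠ k → (i ∈ V ↔ i ∈ W) := by
        rcases hVW' with rfl | rfl
        · simp
        · intro i hi
          simp [mem_shift, hi]
      have h3 : bitIndex k hk V l hl = bitIndex k hk (shift i W) l hl :=
        bitIndex_congr hk hl fun m hm => by
          rw [mem_shift, hVW' m hm.ne]; simp [(hm.trans hij).ne]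
      rw [h3, bitIndex_mem_bits hsel₂ hk (Set.mem_insert _ _), ← h3, mem_shift,
        hVW' l hl.ne']
      have h5 := bitIndex_eq_iff (hk := hk) (hk' := hj) (W := V) (V := W) (hl := hl) (hl' := hij)
      have h4 : ∀ m < k, m ∈ V ↔ m ∈ W := fun m hm => hVW' m hm.ne
      tauto
    · rw [bitIndex_mem_bits (h₂ k hk) hk (Or.inr ⟨hV, hVW⟩), ne_eq, bitIndex_eq_iff]
      simp only [true_iff]
      rintro ⟨rfl, rfl, h⟩
      exact hVW (hsel₁.mk_shift_eq hV he h)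
  · left
    have hj' : j ∈ firstDirs n r := mem_firstDirs.2 (not_le.1 hj)
    -- The slide direction `i` may be contracted; the slide then moves between parallel edges of the
    -- contraction.
    refine ⟨⟨e, ⟨he, j, hj', hej⟩, i, j, hej, hji, fun h => hne h.1, ?_⟩, ?_⟩
    · ext f
      by_cases hf : f = shiftEdge i e
      · subst hf
        simpa [dirPart] using ⟨j, hj', hej'⟩
      · simp only [dirPart, Set.mem_ofPred_eq, Set.mem_insert_iff, hf, false_or, Set.mem_sdiff,
          Set.mem_singleton_iff]
        tauto
    · ext p
      refine exists_congr fun W => and_congr_left fun _ => ?_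
      have hp : ¬ HasDir s(W, shift p.1.1 W) j := fun h => by
        have h1 := h.unique ⟨W, rfl⟩
        have h2 := p.2.1
        rw [← h1] at h2
        exact hj h2
      have h1 : s(W, shift p.1.1 W) ≠ e := fun h => hp (h ▸ hej)
      have h2 : s(W, shift p.1.1 W) ≠ shiftEdge i e := fun h => hp (h ▸ hej')
      simp [h1, h2]

theorem setSlide_of_dirPart (hd₁ : ∀ e ∈ F₁, ∃ i, HasDir e i) (hd₂ : ∀ e ∈ F₂, ∃ i, HasDir e i)
    (h₁ : ∀ k : Fin n, r ≤ k → Selective F₁ k) (h₂ : ∀ k : Fin n, r ≤ k → Selective F₂ k)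
    (h : SetSlide (dirPart F₁ (firstDirs n r)) (dirPart F₂ (firstDirs n r)))
    (hb : bits r F₁ = bits r F₂) : SetSlide F₁ F₂ := by
  obtain ⟨e, ⟨he, k, hk, hek⟩, i, j, hej, hji, hne, h⟩ := h
  obtain rfl := hek.unique hej
  have hek' := hek.shiftEdge i
  refine ⟨e, he, i, k, hek, hji, fun h => hne ⟨h, k, hk, hek'⟩, ?_⟩
  ext f
  by_cases hf : ∃ m, HasDir f m
  swap
  · have h1 := mt (hd₂ f) hf
    have h2 := mt (hd₁ f) hf
    have h3 : f ≠ shiftEdge i e := fun h => hf ⟨k, h ▸ hek'⟩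
    simp [h1, h2, h3]
  obtain ⟨m, W, rfl⟩ := hf
  by_cases hm : r ≤ m
  · have hp : ¬ HasDir s(W, shift m W) k := fun h => by
      rw [mem_firstDirs, h.unique ⟨W, rfl⟩] at hk
      omega
    have h1 : s(W, shift m W) ≠ e := fun h => hp (h ▸ hek)
    have h2 : s(W, shift m W) ≠ shiftEdge i e := fun h => hp (h ▸ hek')
    rw [mk_shift_mem_iff_bits (h₂ m hm) hm, ← hb, ← mk_shift_mem_iff_bits (h₁ m hm) hm]
    simp [h1, h2]
  · have hm' : ∃ i ∈ firstDirs n r, HasDir s(W, shift m W) i :=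
      ⟨m, mem_firstDirs.2 (not_le.1 hm), W, rfl⟩
    have := Set.ext_iff.1 h s(W, shift m W)
    simpa [dirPart, hm'] using this

/-- Flipping the bit `(k, X, l)` slides the edge in direction `k` over `X` along `l`; all other
edges are fixed by the unchanged bits and the common low part. -/
theorem setSlide_of_bits (hd₁ : ∀ e ∈ F₁, ∃ i, HasDir e i) (hd₂ : ∀ e ∈ F₂, ∃ i, HasDir e i)
    (h₁ : ∀ k : Fin n, r ≤ k → Selective F₁ k) (h₂ : ∀ k : Fin n, r ≤ k → Selective F₂ k)
    (h : dirPart F₁ (firstDirs n r) = dirPart F₂ (firstDirs n r))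
    (hb : (flipGraph (BitIndex n r)).Adj (bits r F₁) (bits r F₂)) : SetSlide F₁ F₂ := by
  obtain ⟨p, hp⟩ := hb
  obtain ⟨k, hk, X, l, hl, rfl⟩ := exists_eq_bitIndex p
  obtain ⟨W, hW, hWX⟩ := (h₁ k hk).exists_mem X
  rw [← bitIndex_congr hk hl hWX] at hp
  have hWl : ∀ i, i ≠ l → (i ∈ shift l W ↔ i ∈ W) := fun i hi => by simp [mem_shift, hi]
  have hbelow : ∀ i < k, i ∈ shift l W ↔ i ∈ W := fun i hi => hWl i (hi.trans hl).ne
  have hsl : s(shift l W, shift k (shift l W)) ∈ F₂ := by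
    rw [mk_shift_mem_iff_bits (h₂ k hk) hk]
    intro m hm
    have h3 := hp (bitIndex k hk W m hm)
    rw [bitIndex_mem_bits (h₁ k hk) hk hW, ne_eq, bitIndex_eq_iff] at h3
    rw [bitIndex_congr hk hm hbelow, mem_shift]
    simp only [true_and] at h3
    tauto
  have hsl' : s(shift l W, shift k (shift l W)) ∉ F₁ := fun h => by
    have := (h₁ k hk).unique _ _ h hW hbelow l hl
    simp [mem_shift] at this
  have hW' : s(W, shift k W) ∉ F₂ := fun h => by
    have := (h₂ k hk).unique _ _ hsl h hbelow l hl
    simp [mem_shift] at this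
  refine ⟨s(W, shift k W), hW, l, k, ⟨W, rfl⟩, hl.ne, by rwa [shiftEdge_mk_shift], ?_⟩
  rw [shiftEdge_mk_shift]
  ext f
  by_cases hf : ∃ m, HasDir f m
  swap
  · have h1 := mt (hd₂ f) hf
    have h2 := mt (hd₁ f) hf
    have h3 : f ≠ s(shift l W, shift k (shift l W)) := fun h => hf ⟨k, shift l W, h⟩
    simp [h1, h2, h3]
  obtain ⟨m, V, rfl⟩ := hf
  -- Over the lower set of the moved edge each tree has a single edge in direction `k`; away from it
  -- the two trees agree.
  by_cases hVW : m = k ∧ ∀ i < k, i ∈ V ↔ i ∈ W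
  · obtain ⟨rfl, hVW⟩ := hVW
    have h3 : s(V, shift m V) ∈ F₂ ↔
        (s(V, shift m V) : Edge n) = s(shift l W, shift m (shift l W)) :=
      ⟨fun h => (h₂ m hk).mk_shift_eq h hsl fun i hi => by rw [hVW i hi, hbelow i hi],
        fun h => h ▸ hsl⟩
    have h4 : s(V, shift m V) ∈ F₁ → (s(V, shift m V) : Edge n) = s(W, shift m W) :=
      fun h => (h₁ m hk).mk_shift_eq h hW hVW
    rw [h3, Set.mem_insert_iff, Set.mem_sdiff, Set.mem_singleton_iff]
    tauto
  · have hne : ∀ U : Finset (Fin n), (∀ i < k, i ∈ U ↔ i ∈ W) →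
        (s(V, shift m V) : Edge n) ≠ s(U, shift k U) := by
      intro U hU h
      obtain ⟨rfl, h⟩ := mk_shift_eq_mk_shift_iff.1 h
      refine hVW ⟨rfl, fun i hi => ?_⟩
      rw [← hU i hi]
      rcases h with rfl | rfl
      · rfl
      · simp [mem_shift, hi.ne]
    have h3 := hne W fun _ _ => Iff.rfl
    have h4 := hne (shift l W) hbelow
    have h5 : s(V, shift m V) ∈ F₂ ↔ s(V, shift m V) ∈ F₁ := by
      by_cases hm : r ≤ m
      · rw [mk_shift_mem_iff_bits (h₂ m hm) hm, mk_shift_mem_iff_bits (h₁ m hm) hm]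
        refine forall₂_congr fun q hq => ?_
        rw [(hp (bitIndex m hm V q hq)).2]
        rw [ne_eq, bitIndex_eq_iff]
        rintro ⟨rfl, rfl, h⟩
        exact hVW ⟨rfl, h⟩
      · have hm' : ∃ i ∈ firstDirs n r, HasDir s(V, shift m V) i :=
          ⟨m, mem_firstDirs.2 (not_le.1 hm), V, rfl⟩
        have := Set.ext_iff.1 h s(V, shift m V)
        simpa [dirPart, hm'] using this.symm
    rw [h5, Set.mem_insert_iff, Set.mem_sdiff, Set.mem_singleton_iff]
    tauto

end Slide

/-! ### The number of bits -/

theorem sum_two_pow_mul (m : ℕ) :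
    ∑ j ∈ Finset.range m, 2 ^ j * (m - 1 - j) + m + 1 = 2 ^ m := by
  induction m with
  | zero => simp
  | succ m ih =>
    have : ∀ j ∈ Finset.range m, 2 ^ (j + 1) * (m + 1 - 1 - (j + 1)) =
        2 * (2 ^ j * (m - 1 - j)) := fun j _ => by
      rw [show m + 1 - 1 - (j + 1) = m - 1 - j by omega]
      ring
    -- Splitting off the term `j = 0` leaves exactly twice the sum for `m`.
    rw [Finset.sum_range_succ', Finset.sum_congr rfl this, ← Finset.mul_sum, pow_succ, ← ih]
    simp
    ring

/-- Direction `k` contributes `2 ^ k` lower sets times `n - 1 - k` higher directions; the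
substitution `k = r + j` pulls out `2 ^ r`. -/
theorem card_bitIndex {n r : ℕ} (hrn : r ≤ n) :
    Nat.card (BitIndex n r) = 2 ^ r * (2 ^ (n - r) - (n - r) - 1) := by
  classical
  obtain ⟨m, rfl⟩ := Nat.exists_eq_add_of_le hrn
  have h1 : Nat.card (BitIndex (r + m) r) =
      ((Finset.univ.filter fun k : Fin (r + m) => r ≤ k).biUnion fun k =>
        {k} ×ˢ (firstDirs (r + m) k).powerset ×ˢ Finset.Ioi k).card := by
    rw [← Set.ncard_coe_finset, ← Nat.card_coe_set_eq]
    refine Nat.card_congr (Equiv.subtypeEquivRight fun p => ?_)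
    obtain ⟨k, X, l⟩ := p
    simp only [Finset.coe_biUnion, Set.mem_iUnion, Finset.mem_coe, Finset.mem_filter,
      Finset.mem_univ, true_and, Finset.mem_product, Finset.mem_singleton, Finset.mem_powerset,
      Finset.mem_Ioi, exists_prop]
    exact ⟨fun h => ⟨k, h.1, rfl, h.2⟩, fun ⟨_, h, rfl, h'⟩ => ⟨h, h'⟩⟩
  have h2 : ∀ k : Fin (r + m), ({k} ×ˢ (firstDirs (r + m) k).powerset ×ˢ Finset.Ioi k).card =
      2 ^ (k : ℕ) * (r + m - 1 - k) := fun k => by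
    rw [Finset.card_product, Finset.card_product, Finset.card_singleton, Finset.card_powerset,
      card_firstDirs k.2.le, Fin.card_Ioi, one_mul]
  rw [h1, Finset.card_biUnion, Finset.sum_congr rfl fun k _ => h2 k, Finset.sum_filter,
    Fin.sum_univ_eq_sum_range (fun k => if r ≤ k then 2 ^ k * (r + m - 1 - k) else 0),
    Finset.sum_range_add, Finset.sum_eq_zero fun k hk => if_neg (by simpa using hk), zero_add]
  · rw [show r + m - r = m by omega, Nat.sub_sub, ← sum_two_pow_mul m, add_assoc _ m 1,
      Nat.add_sub_cancel_right, Finset.mul_sum]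
    refine Finset.sum_congr rfl fun j _ => ?_
    rw [if_pos (by omega), show r + m - 1 - (r + j) = m - 1 - j by omega]
    ring
  · intro k _ k' _ hkk
    refine Finset.disjoint_left.2 fun p hp hp' => hkk ?_
    simp only [Finset.mem_product, Finset.mem_singleton] at hp hp'
    exact hp.1.symm.trans hp'.1

/-! ### Cubes and their powers as flip graphs -/

/-- Reindexing the elements of the ground set. -/
def flipGraphCongr {J K : Type*} (e : J ≃ K) : flipGraph J ≃g flipGraph K where
  toEquiv := Equiv.Set.congr e
  map_rel_iff' := by
    intro P Q
    simp only [flipGraph, Equiv.Set.congr_apply]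
    rw [← e.exists_congr_right]
    refine exists_congr fun j => ?_
    rw [← e.forall_congr_right]
    refine forall_congr' fun i => ?_
    simp

theorem cube_adj_iff {n : ℕ} {X Y : Finset (Fin n)} :
    (cube n).Adj X Y ↔ ∃ j, ∀ i, (i ∈ X ↔ i ∈ Y) ↔ i ≠ j := by
  simp only [cube, Finset.card_eq_one, Finset.ext_iff, Finset.mem_symmDiff, Finset.mem_singleton]
  exact exists_congr fun j => forall_congr' fun i => by tauto

/-- The cube as a graph on sets. -/
noncomputable def cubeIsoFlipGraph (n : ℕ) : cube n ≃g flipGraph (Fin n) where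
  toEquiv := Fintype.finsetEquivSet
  map_rel_iff' := by
    intro X Y
    simp [cube_adj_iff, flipGraph]

open Classical in
/-- A power of a cube is a cube. -/
noncomputable def boxPowCubeIso (M m : ℕ) : boxPow (cube M) m ≃g flipGraph (Fin m × Fin M) where
  toFun f := {p | p.2 ∈ f p.1}
  invFun P i := Finset.univ.filter fun j => (i, j) ∈ P
  left_inv f := by ext; simp
  right_inv P := by ext; simp
  map_rel_iff' := by
    intro f g
    simp only [boxPow, flipGraph, Equiv.coe_fn_mk, Set.mem_ofPred_eq, cube_adj_iff]
    constructor
    · rintro ⟨⟨i, j⟩, h⟩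
      refine ⟨i, ⟨j, fun l => ?_⟩, fun k hk => ?_⟩
      · simpa using h (i, l)
      · ext l
        exact (h (k, l)).2 (by simp [hk])
    · rintro ⟨i, ⟨j, hj⟩, h⟩
      refine ⟨(i, j), fun ⟨k, l⟩ => ?_⟩
      by_cases hk : k = i
      · subst hk
        simpa using hj l
      · simp [h k hk, hk]

/-- The Cartesian product is functorial in its second factor. -/
def boxProdCongrRight {V W W' : Type*} (G : SimpleGraph V) {H : SimpleGraph W}
    {H' : SimpleGraph W'} (e : H ≃g H') : G.boxProd H ≃g G.boxProd H' where
  toEquiv := Equiv.prodCongr (Equiv.refl V) e.toEquiv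
  map_rel_iff' := by
    intro x y
    simp [SimpleGraph.boxProd_adj, e.map_adj_iff]

/-! ### Assembling the isomorphism -/

section Main

variable {n r : ℕ} {a : Fin n → ℕ}

theorem exists_hasDir_of_spans {R : Finset (Fin n)} {F : Set (Edge n)} (hF : Spans R F) :
    ∀ e ∈ F, ∃ i, HasDir e i := fun e he =>
  let ⟨i, _, hi⟩ := (spans_iff.1 hF).1 e he
  ⟨i, hi⟩

theorem ncard_hasDir_extend (ha : Monotone a) (hs : SaturatedAbove a r) {F : Set (Edge n)}
    (P : Set (BitIndex n r)) (hF : ∀ e ∈ F, ∃ i ∈ firstDirs n r, HasDir e i)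
    (hsig : ∀ i ∈ firstDirs n r, {e : Edge n | e ∈ F ∧ HasDir e i}.ncard = a i) (i : Fin n) :
    {e : Edge n | e ∈ extend F P ∧ HasDir e i}.ncard = a i := by
  by_cases hi : r ≤ i
  · rw [(selective_extend P hF hi).ncard_hasDir, hs.apply ha i hi]
  · have hi' : i ∈ firstDirs n r := mem_firstDirs.2 (not_le.1 hi)
    rw [← hsig i hi']
    congr 1
    ext e
    refine and_congr_left fun hei => ?_
    have := Set.ext_iff.1 (dirPart_extend P hF) e
    rw [← this]
    exact (and_iff_left ⟨i, hi', hei⟩).symm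

theorem spans_extend (hrn : r ≤ n) (ha : Monotone a) (hs : SaturatedAbove a r) {F : Set (Edge n)}
    (P : Set (BitIndex n r)) (hF : Spans (firstDirs n r) F)
    (hsig : ∀ i ∈ firstDirs n r, {e : Edge n | e ∈ F ∧ HasDir e i}.ncard = a i) :
    Spans Finset.univ (extend F P) := by
  obtain ⟨h1, h2, -⟩ := spans_iff.1 hF
  refine spans_univ_of_selective (a := a) (r := r) ?_ hrn ?_ (h2.mono fun e he => Or.inl he)
    (fun k hk => selective_extend P h1 hk) (ncard_hasDir_extend ha hs P h1 hsig)
  · rw [← firstDirs_self, hs.sum_firstDirs ha hrn le_rfl]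
  · rintro e (h | ⟨k, _, W, rfl, _⟩)
    · exact exists_hasDir_of_spans hF e h
    · exact ⟨k, W, rfl⟩

theorem spans_of_mem_sigTrees (T : sigTrees a) : Spans Finset.univ T.1.1 :=
  spans_univ_iff.2 T.1.2

theorem ncard_hasDir_of_mem_sigTrees (T : sigTrees a) (i : Fin n) :
    {e : Edge n | e ∈ T.1.1 ∧ HasDir e i}.ncard = a i := congrFun T.2 i

theorem ncard_hasDir_of_mem_contractionTrees {R : Finset (Fin n)}
    (T : contractionTrees R fun i => a i.1) :
    ∀ i ∈ R, {e : Edge n | e ∈ T.1.1 ∧ HasDir e i}.ncard = a i := fun i hi => T.2 ⟨i, hi⟩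

theorem ncard_hasDir_dirPart {R : Finset (Fin n)} {F : Set (Edge n)} {i : Fin n} (hi : i ∈ R) :
    {e : Edge n | e ∈ dirPart F R ∧ HasDir e i}.ncard =
      {e : Edge n | e ∈ F ∧ HasDir e i}.ncard := by
  congr 1
  ext e
  exact and_congr_left fun h => and_iff_left ⟨i, hi, h⟩

/-- The slide graph of a signature that is saturated above `r` splits off a cube: a spanning tree
is determined by a spanning tree of the contraction and a free choice of bits. -/
def sigSlideGraphIso (hrn : r ≤ n) (ha : Monotone a) (hs : SaturatedAbove a r) :
    sigSlideGraph a ≃g (contractionSlideGraph (firstDirs n r) fun i => a i.1).boxProd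
      (flipGraph (BitIndex n r)) where
  toFun T := (⟨⟨dirPart T.1.1 (firstDirs n r), (spans_of_mem_sigTrees T).dirPart
      (ncard_hasDir_of_mem_sigTrees T) hrn (hs.sum_firstDirs ha le_rfl hrn)⟩, fun i =>
      (ncard_hasDir_dirPart i.2).trans (ncard_hasDir_of_mem_sigTrees T i.1)⟩, bits r T.1.1)
  invFun x := ⟨⟨extend x.1.1.1 x.2, spans_univ_iff.1 (spans_extend hrn ha hs x.2 x.1.1.2
      (ncard_hasDir_of_mem_contractionTrees x.1))⟩, funext (ncard_hasDir_extend ha hs x.2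
      (spans_iff.1 x.1.1.2).1 (ncard_hasDir_of_mem_contractionTrees x.1))⟩
  left_inv T := by
    refine Subtype.ext (Subtype.ext ?_)
    exact extend_bits (exists_hasDir_of_spans (spans_of_mem_sigTrees T)) fun k hk =>
      (spans_of_mem_sigTrees T).selective ha hs (ncard_hasDir_of_mem_sigTrees T) k hk
  right_inv x := by
    have h := (spans_iff.1 x.1.1.2).1
    exact Prod.ext (Subtype.ext (Subtype.ext (dirPart_extend x.2 h))) (bits_extend x.2 h)
  map_rel_iff' := by
    intro T₁ T₂
    have hsel : ∀ T : sigTrees a, ∀ k : Fin n, r ≤ k → Selective T.1.1 k := fun T k hk =>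
      (spans_of_mem_sigTrees T).selective ha hs (ncard_hasDir_of_mem_sigTrees T) k hk
    have hdir : ∀ T : sigTrees a, ∀ e ∈ T.1.1, ∃ i, HasDir e i := fun T =>
      exists_hasDir_of_spans (spans_of_mem_sigTrees T)
    rw [SimpleGraph.boxProd_adj]
    constructor
    · rintro (⟨h, hb⟩ | ⟨hb, h⟩)
      · exact setSlide_of_dirPart (hdir T₁) (hdir T₂) (hsel T₁) (hsel T₂) h hb
      · exact setSlide_of_bits (hdir T₁) (hdir T₂) (hsel T₁) (hsel T₂)
          (congrArg (fun T => T.1.1) h) hb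
    · intro h
      exact (SetSlide.dirPart_bits (hsel T₁) (hsel T₂) h).imp id fun h =>
        ⟨h.1, Subtype.ext (Subtype.ext h.2)⟩

end Main

end EdgeSlide

theorem corollary6p10 (n r : ℕ) (hr : 1 ≤ r) (hrn : r ≤ n) (a : Fin n → ℕ)
    (ha : EdgeSlide.IsSignature a) (hord : Monotone a) (hsat : EdgeSlide.SaturatedAbove a r) :
    Nonempty (EdgeSlide.sigSlideGraph a ≃g
      (EdgeSlide.contractionSlideGraph (EdgeSlide.firstDirs n r) (fun i => a i.1)).boxProd
        (EdgeSlide.boxPow (EdgeSlide.cube (2 ^ (n - r) - (n - r) - 1)) (2 ^ r))) ∧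
    Nonempty (EdgeSlide.sigSlideGraph a ≃g
      (EdgeSlide.contractionSlideGraph (EdgeSlide.firstDirs n r) (fun i => a i.1)).boxProd
        (EdgeSlide.cube (2 ^ r * (2 ^ (n - r) - (n - r) - 1)))) := by
  let e := EdgeSlide.flipGraphCongr (Finite.equivFinOfCardEq (EdgeSlide.card_bitIndex hrn))
  let f := EdgeSlide.sigSlideGraphIso hrn hord hsat
  -- Both forms come from the same flip graph: its index set is enumerated by `Fin N`, which is
  -- either split as a product of `Fin (2 ^ r)` with the coordinates of one factor or used directly.
  exact ⟨⟨f.trans (EdgeSlide.boxProdCongrRight _ (e.trans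
    ((EdgeSlide.flipGraphCongr finProdFinEquiv).symm.trans
      (EdgeSlide.boxPowCubeIso _ _).symm)))⟩,
    ⟨f.trans (EdgeSlide.boxProdCongrRight _ (e.trans (EdgeSlide.cubeIsoFlipGraph _).symm))⟩⟩
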